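/- **Theorem 2 (Cut-elimination).** Formulas are given by $A ::= p \mid \bar p \mid A\wedge A \mid A\vee A \mid \Box A \mid \Diamond A$, where $p$ ranges over propositional variables; $\bar A$ denotes the negation of $A$, defined by de Morgan duality. A *nested sequent* is a finite multiset of formulas and of boxed sequents $[\Delta]$, where $\Delta$ is a nested sequent. A context $\Gamma\{\ \}$ is a nested sequent with one hole in place of a formula (possibly inside nested boxes, but not inside a formula), and $\Gamma\{\Delta\}$ is the result of putting the sequent $\Delta$ into the hole. The system $\mathsf{nK}$ has the rules $$\frac{}{\Gamma\{p,\bar p\}}\ \mathsf{id}\qquad \frac{\Gamma\{A,B\}}{\Gamma\{A\vee B\}}\ \vee\qquad \frac{\Gamma\{A\}\quad\Gamma\{B\}}{\Gamma\{A\wedge B\}}\ \wedge\qquad \frac{\Gamma\{[A]\}}{\Gamma\{\Box A\}}\ \Box\qquad \frac{\Gamma\{\Diamond A,[A,\Delta]\}}{\Gamma\{\Diamond A,[\Delta]\}}\ \Diamond$$ and, further, $$\frac{\Gamma\{A\}\quad\Gamma\{\bar A\}}{\Gamma\{\varnothing\}}\ \mathsf{cut}\qquad \frac{\Gamma\{\Diamond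 A,[\Delta_1,[\dots,[\Delta_{n-1},[A,\Delta_n]]\dots]]\}}{\Gamma\{\Diamond A,[\Delta_1,[\dots,[\Delta_{n-1},[\Delta_n]]\dots]]\}}\ \Diamond_{\mathsf{k}n}\quad(n\ge 1).$$ For $Y\subseteq\{n\in\mathbb N: n\ge 1\}$ put $\Diamond_{\mathsf{k}Y}=\{\Diamond_{\mathsf{k}n}: n\in Y\}$. A sequent is provable in a system if it is the root of a finite tree built from the rules of the system, all of whose leaves are instances of $\mathsf{id}$. Let $X\subseteq\{n\in\mathbb N: n>1\}$, and let $\hat X=\bigcup_{p\ge 0}X_p$ be its completion, where $X_0=X$ and $X_{p+1}=X_p\cup\{m+n-1: m,n\in X_p\}$. Let $\Gamma$ be a nested sequent. If $\Gamma$ is provable in $\mathsf{nK}+\Diamond_{\mathsf{k}\hat X}+\mathsf{cut}$, then $\Gamma$ is provable in $\mathsf{nK}+\Diamond_{\mathsf{k}\hat X}$. -/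

import Mathlib

namespace NestedModal

universe u

/-- Modal formulas in negation normal form over the propositional variables `α`. -/
inductive Formula (α : Type u) : Type u
  | atom (p : α)
  | natom (p : α)
  | and (A B : Formula α)
  | or (A B : Formula α)
  | box (A : Formula α)
  | dia (A : Formula α)

/-- Negation, by de Morgan duality. -/
def Formula.neg {α : Type u} : Formula α → Formula α
  | .atom p => .natom p
  | .natom p => .atom p
  | .and A B => .or A.neg B.neg
  | .or A B => .and A.neg B.neg
  | .box A => .dia A.neg
  | .dia A => .box A.neg

/-- Written nested sequents: `Γ ::= ∅ | A, Γ | [Δ], Γ`, where the order of writing still counts. -/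
inductive PreSeq (α : Type u) : Type u
  | nil
  | fml (A : Formula α) (Γ : PreSeq α)
  | brk (Δ Γ : PreSeq α)

namespace PreSeq

variable {α : Type u}

/-- Two written sequents denote the same multiset of formulas and boxed sequents: permutations of
the entries, at every level of nesting. -/
inductive Perm : PreSeq α → PreSeq α → Prop
  | nil : Perm .nil .nil
  | fml (A : Formula α) {Γ Γ' : PreSeq α} : Perm Γ Γ' → Perm (.fml A Γ) (.fml A Γ')
  | brk {Δ Δ' Γ Γ' : PreSeq α} : Perm Δ Δ' → Perm Γ Γ' → Perm (.brk Δ Γ) (.brk Δ' Γ')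
  | swap_fml_fml (A B : Formula α) (Γ : PreSeq α) :
      Perm (.fml A (.fml B Γ)) (.fml B (.fml A Γ))
  | swap_fml_brk (A : Formula α) (Δ Γ : PreSeq α) :
      Perm (.fml A (.brk Δ Γ)) (.brk Δ (.fml A Γ))
  | swap_brk_brk (Δ Θ Γ : PreSeq α) :
      Perm (.brk Δ (.brk Θ Γ)) (.brk Θ (.brk Δ Γ))
  | symm {Γ Δ : PreSeq α} : Perm Γ Δ → Perm Δ Γ
  | trans {Γ Δ Θ : PreSeq α} : Perm Γ Δ → Perm Δ Θ → Perm Γ Θ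

theorem Perm.refl : ∀ Γ : PreSeq α, Perm Γ Γ
  | .nil => .nil
  | .fml A Γ => .fml A (Perm.refl Γ)
  | .brk Δ Γ => .brk (Perm.refl Δ) (Perm.refl Γ)

instance setoid (α : Type u) : Setoid (PreSeq α) :=
  ⟨Perm, ⟨Perm.refl, Perm.symm, Perm.trans⟩⟩

/-- Juxtaposition `Γ, Δ`. -/
def append : PreSeq α → PreSeq α → PreSeq α
  | .nil, Δ => Δ
  | .fml A Γ, Δ => .fml A (append Γ Δ)
  | .brk Θ Γ, Δ => .brk Θ (append Γ Δ)

theorem append_right (Γ : PreSeq α) {Δ Δ' : PreSeq α} (h : Perm Δ Δ') :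
    Perm (append Γ Δ) (append Γ Δ') := by
  induction Γ with
  | nil => exact h
  | fml A Γ ih => exact .fml A ih
  | brk Θ Γ _ ih => exact .brk (.refl Θ) ih

theorem append_left {Γ Γ' : PreSeq α} (h : Perm Γ Γ') (Δ : PreSeq α) :
    Perm (append Γ Δ) (append Γ' Δ) := by
  induction h with
  | nil => exact .refl Δ
  | fml A _ ih => exact .fml A ih
  | brk h _ _ ih => exact .brk h ih
  | swap_fml_fml A B Γ => exact .swap_fml_fml A B _
  | swap_fml_brk A Θ Γ => exact .swap_fml_brk A Θ _
  | swap_brk_brk Θ Ξ Γ => exact .swap_brk_brk Θ Ξ _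
  | symm _ ih => exact .symm ih
  | trans _ _ ih₁ ih₂ => exact .trans ih₁ ih₂

end PreSeq

/-- Nested sequents: finite multisets of formulas and boxed nested sequents. -/
def NSeq (α : Type u) : Type u := Quotient (PreSeq.setoid α)

namespace NSeq

variable {α : Type u}

/-- The empty sequent. -/
instance : Zero (NSeq α) := ⟨Quotient.mk _ .nil⟩

/-- `Γ + Δ` is the sequent `Γ, Δ` (multiset union). -/
instance : Add (NSeq α) :=
  ⟨Quotient.map₂ PreSeq.append fun _ Γ' hΓ Δ _ hΔ =>
    (PreSeq.append_left hΓ Δ).trans (PreSeq.append_right Γ' hΔ)⟩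

/-- The sequent consisting of one formula. -/
def fml (A : Formula α) : NSeq α := Quotient.mk _ (.fml A .nil)

/-- The sequent `[Δ]` consisting of one boxed sequent. -/
def brk (Δ : NSeq α) : NSeq α :=
  Quotient.map (fun Δ => PreSeq.brk Δ .nil) (fun _ _ h => PreSeq.Perm.brk h .nil) Δ

/-- `nest [Δ₁, …, Δₙ] Θ` is `[Δ₁, [Δ₂, … [Δₙ, Θ] … ]]`. -/
def nest : List (NSeq α) → NSeq α → NSeq α
  | [], Θ => Θ
  | Δ :: L, Θ => brk (Δ + nest L Θ)

end NSeq

/-- Contexts with one hole: `Γ, { }` or `Γ, [C{ }]`. -/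
inductive Context (α : Type u) : Type u
  | hole (Γ : NSeq α)
  | brk (Γ : NSeq α) (C : Context α)

/-- `C.fill Δ` is `C{Δ}`, the hole replaced by the sequent `Δ`. -/
def Context.fill {α : Type u} : Context α → NSeq α → NSeq α
  | .hole Γ, Δ => Γ + Δ
  | .brk Γ C, Δ => Γ + NSeq.brk (C.fill Δ)

/-- A set of rule instances: `S premisses conclusion`. The sum of two systems is `⊔`. -/
abbrev System (α : Type u) := List (NSeq α) → NSeq α → Prop

open NSeq in
/-- The rules of `nK`. -/
inductive nK {α : Type u} : System α
  | id (C : Context α) (p : α) : nK [] (C.fill (fml (.atom p) + fml (.natom p)))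
  | or (C : Context α) (A B : Formula α) :
      nK [C.fill (fml A + fml B)] (C.fill (fml (.or A B)))
  | and (C : Context α) (A B : Formula α) :
      nK [C.fill (fml A), C.fill (fml B)] (C.fill (fml (.and A B)))
  | box (C : Context α) (A : Formula α) :
      nK [C.fill (brk (fml A))] (C.fill (fml (.box A)))
  | dia (C : Context α) (A : Formula α) (Δ : NSeq α) :
      nK [C.fill (fml (.dia A) + brk (fml A + Δ))] (C.fill (fml (.dia A) + brk Δ))

open NSeq in
/-- The cut rule. -/
inductive cut {α : Type u} : System α
  | mk (C : Context α) (A : Formula α) : cut [C.fill (fml A), C.fill (fml A.neg)] (C.fill 0)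

open NSeq in
/-- The propagation rules `◇_{kn}` for `n ∈ X`: from
`Γ{◇A, [Δ₁, [… [A, Δₙ] …]]}` infer `Γ{◇A, [Δ₁, [… [Δₙ] …]]}`. -/
inductive diaK {α : Type u} (X : Set ℕ) : System α
  | mk (C : Context α) (A : Formula α) (L : List (NSeq α)) (hL : L.length ∈ X) :
      diaK X [C.fill (fml (.dia A) + nest L (fml A))] (C.fill (fml (.dia A) + nest L 0))

/-- `S ⊢ Γ`: there is a finite proof tree with root `Γ` built from the rule instances of `S`. -/
inductive Provable {α : Type u} (S : System α) : NSeq α → Prop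
  | intro {ps : List (NSeq α)} {Γ : NSeq α} :
      S ps Γ → (∀ Δ ∈ ps, Provable S Δ) → Provable S Γ

/-- The stages of the completion: `X₀ = X`, `X_{p+1} = X_p ∪ {m + n - 1 : m, n ∈ X_p}`. -/
def completionStage (X : Set ℕ) : ℕ → Set ℕ
  | 0 => X
  | p + 1 => completionStage X p ∪
      {k | ∃ m ∈ completionStage X p, ∃ n ∈ completionStage X p, k = m + n - 1}

/-- The completion of `X`. -/
def completion (X : Set ℕ) : Set ℕ := ⋃ p, completionStage X p

end NestedModal

/-! The proof is semantic: soundness with cut, completeness without it. Every rule, cut included,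
preserves truth in all worlds of models whose relation contains its `k`-fold compositions for `k ∈
Y` (`Provable.sat`). So it suffices to refute each sequent without a cut-free proof in such a model.

The countermodel comes from a maximal consistent set of labelled formulas and relational atoms,
where consistent means that no finite subset is derivable without cut. The set collects formulas to
be falsified, so only one half of the truth lemma is needed (`MaximalConsistent.not_sat`), and
nothing calls for cut. The rules for `∧`, `∨` and `□` consume their principal formula, whereas a
maximal set keeps it. `Cov` bridges the gap: a formula still counts as present when only its residue
is, which replaces separate weakening and inversion lemmas.

Worlds are related when a path of relational atoms of length 1 or of length in `Y` joins them.
Completion matters only here: replacing one step of a path by `l` steps adds `l - 1` to its length,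
and closure under `m + n - 1` keeps the total in `Y` (`canonicalModel_rel_of_path`). -/

namespace NestedModal

universe u v

variable {α : Type u}

/-! ### Nested sequents as a commutative monoid -/

namespace PreSeq

theorem perm_fml_append (A : Formula α) (Δ Γ : PreSeq α) :
    Perm (fml A (append Δ Γ)) (append Δ (fml A Γ)) := by
  induction Δ with
  | nil => exact .refl _
  | fml B Δ ih => exact (Perm.swap_fml_fml A B _).trans (.fml B ih)
  | brk Θ Δ _ ih => exact (Perm.swap_fml_brk A Θ _).trans (.brk (.refl Θ) ih)

theorem perm_brk_append (Θ Δ Γ : PreSeq α) :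
    Perm (brk Θ (append Δ Γ)) (append Δ (brk Θ Γ)) := by
  induction Δ with
  | nil => exact .refl _
  | fml B Δ ih => exact (Perm.swap_fml_brk B Θ _).symm.trans (.fml B ih)
  | brk Ξ Δ _ ih => exact (Perm.swap_brk_brk Θ Ξ _).trans (.brk (.refl Ξ) ih)

theorem append_nil (Γ : PreSeq α) : append Γ .nil = Γ := by
  induction Γ with
  | nil => rfl
  | fml A Γ ih => simp [append, ih]
  | brk Θ Γ _ ih => simp [append, ih]

theorem append_assoc (Γ Δ Θ : PreSeq α) :
    append (append Γ Δ) Θ = append Γ (append Δ Θ) := by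
  induction Γ with
  | nil => rfl
  | fml A Γ ih => simp [append, ih]
  | brk Θ Γ _ ih => simp [append, ih]

theorem perm_append_comm (Γ Δ : PreSeq α) : Perm (append Γ Δ) (append Δ Γ) := by
  induction Γ with
  | nil => rw [append_nil]; exact .refl _
  | fml A Γ ih => exact (Perm.fml A ih).trans (perm_fml_append A Δ Γ)
  | brk Θ Γ _ ih => exact (Perm.brk (.refl Θ) ih).trans (perm_brk_append Θ Δ Γ)

end PreSeq

namespace NSeq

instance : AddCommMonoid (NSeq α) where
  add_assoc := by
    rintro ⟨a⟩ ⟨b⟩ ⟨c⟩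
    exact congrArg (Quotient.mk _) (PreSeq.append_assoc a b c)
  zero_add := by
    rintro ⟨a⟩
    rfl
  add_zero := by
    rintro ⟨a⟩
    exact congrArg (Quotient.mk _) (PreSeq.append_nil a)
  add_comm := by
    rintro ⟨a⟩ ⟨b⟩
    exact Quotient.sound (PreSeq.perm_append_comm a b)
  nsmul := nsmulRec

/-- The nested sequent denoted by a written sequent. -/
def mk (Γ : PreSeq α) : NSeq α := Quotient.mk _ Γ

theorem mk_nil : (mk .nil : NSeq α) = 0 := rfl

theorem mk_fml (A : Formula α) (Γ : PreSeq α) : mk (.fml A Γ) = fml A + mk Γ := rfl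

theorem mk_brk (Δ Γ : PreSeq α) : mk (.brk Δ Γ) = brk (mk Δ) + mk Γ := rfl

theorem nest_append (L : List (NSeq α)) (Γ Δ : NSeq α) :
    nest (L ++ [Γ]) Δ = nest L (brk (Γ + Δ)) := by
  induction L with
  | nil => rfl
  | cons Θ L ih => simp [nest, ih]

end NSeq

/-! ### Kripke semantics and soundness with cut -/

/-- Kripke models. -/
structure Model (α : Type u) (W : Type v) where
  rel : W → W → Prop
  val : W → α → Prop

/-- There is a path of length `n` along `R`. -/
def Path {W : Type v} (R : W → W → Prop) : ℕ → W → W → Prop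
  | 0, x, y => x = y
  | n + 1, x, y => ∃ z, R x z ∧ Path R n z y

theorem Path.append {W : Type v} {R : W → W → Prop} {m n : ℕ} {x y z : W}
    (h : Path R m x y) (h' : Path R n y z) : Path R (m + n) x z := by
  induction m generalizing x with
  | zero => cases h; simpa using h'
  | succ m ih =>
    obtain ⟨u, hu, h⟩ := h
    rw [Nat.add_right_comm]
    exact ⟨u, hu, ih h⟩

/-- Truth of a formula at a world. -/
def Formula.Sat {W : Type v} (M : Model α W) : Formula α → W → Prop
  | .atom p, x => M.val x p
  | .natom p, x => ¬ M.val x p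
  | .and A B, x => A.Sat M x ∧ B.Sat M x
  | .or A B, x => A.Sat M x ∨ B.Sat M x
  | .box A, x => ∀ y, M.rel x y → A.Sat M y
  | .dia A, x => ∃ y, M.rel x y ∧ A.Sat M y

theorem Formula.sat_neg {W : Type v} (M : Model α W) (A : Formula α) (x : W) :
    A.neg.Sat M x ↔ ¬ A.Sat M x := by
  induction A generalizing x with
  | atom p => simp [Formula.neg, Formula.Sat]
  | natom p => simp [Formula.neg, Formula.Sat]
  | and A B ihA ihB => simp only [Formula.neg, Formula.Sat, ihA, ihB]; tauto
  | or A B ihA ihB => simp only [Formula.neg, Formula.Sat, ihA, ihB]; tauto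
  | box A ih => simp only [Formula.neg, Formula.Sat, ih]; push Not; rfl
  | dia A ih => simp only [Formula.neg, Formula.Sat, ih]; push Not; rfl

/-- Truth of a written sequent at a world: some entry is true. -/
def PreSeq.Sat {W : Type v} (M : Model α W) : PreSeq α → W → Prop
  | .nil, _ => False
  | .fml A Γ, x => A.Sat M x ∨ Γ.Sat M x
  | .brk Δ Γ, x => (∀ y, M.rel x y → Δ.Sat M y) ∨ Γ.Sat M x

theorem PreSeq.Perm.sat_iff {W : Type v} (M : Model α W) {Γ Δ : PreSeq α} (h : Perm Γ Δ) (x : W) :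
    Γ.Sat M x ↔ Δ.Sat M x := by
  induction h generalizing x with
  | nil => rfl
  | fml A _ ih => simp only [PreSeq.Sat, ih]
  | brk _ _ ih₁ ih₂ => simp only [PreSeq.Sat, ih₁, ih₂]
  | swap_fml_fml | swap_fml_brk | swap_brk_brk => simp only [PreSeq.Sat]; tauto
  | symm _ ih => exact (ih x).symm
  | trans _ _ ih₁ ih₂ => exact (ih₁ x).trans (ih₂ x)

theorem PreSeq.sat_append {W : Type v} (M : Model α W) (Γ Δ : PreSeq α) (x : W) :
    (append Γ Δ).Sat M x ↔ Γ.Sat M x ∨ Δ.Sat M x := by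
  induction Γ with
  | nil => simp [append, PreSeq.Sat]
  | fml A Γ ih => simp only [append, PreSeq.Sat, ih, or_assoc]
  | brk Θ Γ _ ih => simp only [append, PreSeq.Sat, ih, or_assoc]

namespace NSeq

/-- Truth of a nested sequent at a world. -/
def Sat {W : Type v} (M : Model α W) (Γ : NSeq α) (x : W) : Prop :=
  Quotient.lift (fun Γ : PreSeq α => Γ.Sat M x) (fun _ _ h => propext (PreSeq.Perm.sat_iff M h x)) Γ

variable {W : Type v} (M : Model α W)

theorem sat_zero (x : W) : ¬ (0 : NSeq α).Sat M x := fun h => h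

theorem sat_add (Γ Δ : NSeq α) (x : W) : (Γ + Δ).Sat M x ↔ Γ.Sat M x ∨ Δ.Sat M x := by
  obtain ⟨Γ⟩ := Γ
  obtain ⟨Δ⟩ := Δ
  exact PreSeq.sat_append M Γ Δ x

theorem sat_fml (A : Formula α) (x : W) : (fml A).Sat M x ↔ A.Sat M x := iff_of_eq (or_false _)

theorem sat_brk (Δ : NSeq α) (x : W) : (brk Δ).Sat M x ↔ ∀ y, M.rel x y → Δ.Sat M y := by
  obtain ⟨Δ⟩ := Δ
  exact iff_of_eq (or_false _)

/-- A world refuting the chain with empty core starts a path along which all side sequents fail. On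
that path the truth of the full chain can only come from `Θ`. -/
theorem exists_path_of_sat_nest (L : List (NSeq α)) (Θ : NSeq α) (x : W)
    (h : (nest L Θ).Sat M x) (h' : ¬ (nest L 0).Sat M x) :
    ∃ y, Path M.rel L.length x y ∧ Θ.Sat M y := by
  induction L generalizing x with
  | nil => exact ⟨x, rfl, h⟩
  | cons Δ L ih =>
    simp only [nest, sat_brk, sat_add, not_forall, not_or] at h h'
    obtain ⟨z, hz, hΔ, hL⟩ := h'
    obtain ⟨y, hy, hΘ⟩ := ih z ((h z hz).resolve_left hΔ) hL
    exact ⟨y, ⟨z, hz, hy⟩, hΘ⟩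

end NSeq

namespace Context

variable {W : Type v} (M : Model α W)

theorem sat_fill {Δ : NSeq α} (h : ∀ y, Δ.Sat M y) (C : Context α) (x : W) :
    (C.fill Δ).Sat M x := by
  induction C generalizing x with
  | hole Γ => exact (NSeq.sat_add M _ _ x).2 (.inr (h x))
  | brk Γ C ih =>
    exact (NSeq.sat_add M _ _ x).2 (.inr ((NSeq.sat_brk M _ x).2 fun y _ => ih y))

/-- A context is built from disjunctions with side sequents and from boxes. Both preserve
implications with two premisses, so rules need checking only at the hole. -/
theorem sat_fill_of_sat_fill₂ {Δ₁ Δ₂ Δ : NSeq α}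
    (h : ∀ y, Δ₁.Sat M y → Δ₂.Sat M y → Δ.Sat M y) (C : Context α) (x : W)
    (h₁ : (C.fill Δ₁).Sat M x) (h₂ : (C.fill Δ₂).Sat M x) : (C.fill Δ).Sat M x := by
  induction C generalizing x with
  | hole Γ =>
    simp only [fill, NSeq.sat_add] at *
    have := h x
    tauto
  | brk Γ C ih =>
    simp only [fill, NSeq.sat_add, NSeq.sat_brk] at *
    rcases h₁ with h₁ | h₁
    · exact .inl h₁
    rcases h₂ with h₂ | h₂
    · exact .inl h₂
    exact .inr fun y hy => ih y (h₁ y hy) (h₂ y hy)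

theorem sat_fill_of_sat_fill {Δ₁ Δ : NSeq α} (h : ∀ y, Δ₁.Sat M y → Δ.Sat M y) (C : Context α)
    (x : W) (h₁ : (C.fill Δ₁).Sat M x) : (C.fill Δ).Sat M x :=
  sat_fill_of_sat_fill₂ M (fun y hy _ => h y hy) C x h₁ h₁

/-- Composition of contexts with a bracket around the inner hole: `C{[Γ, { }]}`. -/
theorem exists_fill_brk (C : Context α) (Γ : NSeq α) :
    ∃ C' : Context α, ∀ Δ, C'.fill Δ = C.fill (NSeq.brk (Γ + Δ)) := by
  induction C with
  | hole Θ => exact ⟨.brk Θ (.hole Γ), fun _ => rfl⟩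
  | brk Θ C ih =>
    obtain ⟨C', h⟩ := ih
    exact ⟨.brk Θ C', fun Δ => by simp only [fill, h]⟩

end Context

/-- Soundness of the calculus with cut for models whose relation contains its `k`-fold
composition, for all `k ∈ Y`. -/
theorem Provable.sat {Y : Set ℕ} {Γ : NSeq α} (h : Provable (nK ⊔ diaK Y ⊔ cut) Γ) {W : Type v}
    (M : Model α W) (hM : ∀ k ∈ Y, ∀ x y, Path M.rel k x y → M.rel x y) (x : W) : Γ.Sat M x := by
  induction h generalizing x with
  | intro hS _ ih =>
    rcases hS with (hS | hS) | hS
    · cases hS with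
      | id C p =>
        refine Context.sat_fill M (fun y => ?_) C x
        simp only [NSeq.sat_add, NSeq.sat_fml, Formula.Sat]
        exact em _
      | or C A B =>
        refine Context.sat_fill_of_sat_fill M (fun y => ?_) C x
          (ih _ (List.mem_singleton_self _) x)
        simp only [NSeq.sat_add, NSeq.sat_fml, Formula.Sat]
        exact _root_.id
      | and C A B =>
        refine Context.sat_fill_of_sat_fill₂ M (fun y => ?_) C x (ih (C.fill (.fml A)) (by simp) x)
          (ih (C.fill (.fml B)) (by simp) x)
        simp only [NSeq.sat_fml, Formula.Sat]
        exact And.intro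
      | box C A =>
        refine Context.sat_fill_of_sat_fill M (fun y => ?_) C x
          (ih _ (List.mem_singleton_self _) x)
        simp only [NSeq.sat_fml, NSeq.sat_brk, Formula.Sat]
        exact _root_.id
      | dia C A Δ =>
        refine Context.sat_fill_of_sat_fill M (fun y => ?_) C x
          (ih _ (List.mem_singleton_self _) x)
        simp only [NSeq.sat_add, NSeq.sat_fml, NSeq.sat_brk, Formula.Sat]
        rintro (h | h)
        · exact .inl h
        · by_cases hA : ∃ z, M.rel y z ∧ A.Sat M z
          · exact .inl hA
          · exact .inr fun z hz => (h z hz).resolve_left fun hz' => hA ⟨z, hz, hz'⟩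
    · cases hS with
      | mk C A L hL =>
        refine Context.sat_fill_of_sat_fill M (fun y => ?_) C x
          (ih _ (List.mem_singleton_self _) x)
        simp only [NSeq.sat_add, NSeq.sat_fml]
        rintro (h | h)
        · exact .inl h
        · by_contra! hn
          obtain ⟨z, hz, hA⟩ := NSeq.exists_path_of_sat_nest M L _ y h hn.2
          exact hn.1 ⟨z, hM _ hL _ _ hz, (NSeq.sat_fml M A z).1 hA⟩
    · cases hS with
      | mk C A =>
        refine Context.sat_fill_of_sat_fill₂ M (fun y => ?_) C x (ih (C.fill (.fml A)) (by simp) x)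
          (ih (C.fill (.fml A.neg)) (by simp) x)
        simp only [NSeq.sat_fml, Formula.sat_neg]
        exact fun h h' => absurd h h'

/-! ### Nested sequents as trees with numbered nodes -/

/-- The nested sequent of a finite tree with nodes `0, …, n`, in which `par i` is the parent of
`i + 1` and `G i` is the sequent at the node `i`: the last node is a leaf, and is absorbed by its
parent. -/
def treeSeq (par : ℕ → ℕ) : ℕ → (ℕ → NSeq α) → NSeq α
  | 0, G => G 0
  | n + 1, G => treeSeq par n (G + Pi.single (par n) (.brk (G (n + 1))))

theorem treeSeq_congr {par par' : ℕ → ℕ} {n : ℕ} {G G' : ℕ → NSeq α}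
    (hpar : ∀ i < n, par i = par' i) (hG : ∀ i ≤ n, G i = G' i) :
    treeSeq par n G = treeSeq par' n G' := by
  induction n generalizing G G' with
  | zero => exact hG 0 le_rfl
  | succ n ih =>
    refine ih (fun i hi => hpar i (by omega)) fun i hi => ?_
    simp only [Pi.add_apply, hG i (by omega), hG (n + 1) le_rfl, hpar n (by omega)]

/-- The node `v` of a tree is a child of the node `w`. -/
def IsChild (par : ℕ → ℕ) (n w v : ℕ) : Prop := ∃ i < n, v = i + 1 ∧ par i = w

theorem IsChild.lt {par : ℕ → ℕ} (hpar : ∀ i, par i ≤ i) {n w v : ℕ} (h : IsChild par n w v) :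
    w < v ∧ v ≤ n := by
  obtain ⟨i, hi, rfl, rfl⟩ := h
  exact ⟨Nat.lt_succ_of_le (hpar i), hi⟩

theorem Path.le_of_isChild {par : ℕ → ℕ} (hpar : ∀ i, par i ≤ i) {n k w v : ℕ}
    (h : Path (IsChild par n) k w v) : w + k ≤ v := by
  induction k generalizing w with
  | zero => cases h; rfl
  | succ k ih =>
    obtain ⟨z, hz, h⟩ := h
    have := hz.lt hpar
    have := ih h
    omega

theorem Path.isChild_restrict {par : ℕ → ℕ} (hpar : ∀ i, par i ≤ i) {n k w v : ℕ} (hv : v ≤ n)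
    (h : Path (IsChild par (n + 1)) k w v) : Path (IsChild par n) k w v := by
  induction k generalizing w with
  | zero => exact h
  | succ k ih =>
    obtain ⟨z, ⟨i, hi, rfl, hw⟩, h⟩ := h
    have := h.le_of_isChild hpar
    exact ⟨i + 1, ⟨i, by omega, rfl, hw⟩, ih h⟩

theorem Path.exists_last {W : Type v} {R : W → W → Prop} {k : ℕ} {x y : W}
    (h : Path R (k + 1) x y) : ∃ z, Path R k x z ∧ R z y := by
  induction k generalizing x with
  | zero =>
    obtain ⟨z, hz, rfl⟩ := h
    exact ⟨x, rfl, hz⟩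
  | succ k ih =>
    obtain ⟨z, hz, h⟩ := h
    obtain ⟨u, hu, h⟩ := ih h
    exact ⟨u, ⟨z, hz, hu⟩, h⟩

/-- Two nodes at distance `k` on a branch of a tree give a context with a hole at the upper node
and a chain of `k` brackets down to the lower one. -/
theorem exists_fill_eq_treeSeq {par : ℕ → ℕ} (hpar : ∀ i, par i ≤ i) {n k w v : ℕ} (hv : v ≤ n)
    (h : Path (IsChild par n) k w v) (G : ℕ → NSeq α) :
    ∃ (C : Context α) (L : List (NSeq α)), L.length = k ∧ ∀ Θ Δ,
      treeSeq par n (G + Pi.single w Θ + Pi.single v Δ) = C.fill (Θ + NSeq.nest L Δ) := by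
  induction n generalizing k w v G with
  | zero =>
    have := h.le_of_isChild hpar
    obtain rfl : v = 0 := by omega
    obtain rfl : k = 0 := by omega
    obtain rfl : w = 0 := by omega
    exact ⟨.hole (G 0), [], rfl, fun Θ Δ => by
      simp [treeSeq, Context.fill, NSeq.nest, add_assoc]⟩
  | succ n ih =>
    have hle := h.le_of_isChild hpar
    have hpn := hpar n
    -- If `v` is not the last node, neither is `w`, and the leaf `n + 1` is mere side material of
    -- its parent. Otherwise `v` is that leaf, either equal to `w` or closing the chain of brackets
    -- below `w`.
    rcases hv.lt_or_eq with hv | rfl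
    · obtain ⟨C, L, hL, hC⟩ := ih (by omega) (h.isChild_restrict hpar (by omega))
        (G + Pi.single (par n) (.brk (G (n + 1))))
      refine ⟨C, L, hL, fun Θ Δ => ?_⟩
      rw [← hC, treeSeq]
      have hw' : n + 1 ≠ w := by omega
      have hv' : n + 1 ≠ v := by omega
      simp only [Pi.add_apply, Pi.single_eq_of_ne hw', Pi.single_eq_of_ne hv', add_zero]
      congr 1
      abel
    · cases k with
      | zero =>
        obtain rfl : w = n + 1 := h
        -- The context with its hole at the parent, extended by the bracket of the leaf.
        obtain ⟨C, L, hL, hC⟩ := ih (k := 0) (w := par n) (v := par n) (by omega) rfl G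
        obtain ⟨C', hC'⟩ := C.exists_fill_brk (G (n + 1))
        refine ⟨C', [], rfl, fun Θ Δ => ?_⟩
        rw [hC', NSeq.nest]
        rw [List.length_eq_zero_iff] at hL
        subst hL
        have := hC 0 (.brk (G (n + 1) + (Θ + Δ)))
        simp only [NSeq.nest, zero_add, Pi.single_zero, add_zero] at this
        rw [← this, treeSeq]
        refine treeSeq_congr (fun _ _ => rfl) fun i hi => ?_
        have hi' : i ≠ n + 1 := by omega
        simp [hi', add_assoc]
      | succ k =>
        obtain ⟨z, hz, i, hi, hi', rfl⟩ := h.exists_last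
        obtain rfl : n = i := by omega
        obtain ⟨C, L, hL, hC⟩ := ih (by omega) (hz.isChild_restrict hpar (by omega)) G
        -- The chain down to the parent of the leaf gains the leaf as its innermost bracket.
        refine ⟨C, L ++ [G (n + 1)], by simp [hL], fun Θ Δ => ?_⟩
        rw [NSeq.nest_append, ← hC, treeSeq]
        have hw' : n + 1 ≠ w := by omega
        refine treeSeq_congr (fun _ _ => rfl) fun i hi => ?_
        have hi' : i ≠ n + 1 := by omega
        simp [hi', hw']

theorem exists_fill_eq_treeSeq_node {par : ℕ → ℕ} (hpar : ∀ i, par i ≤ i) {n w : ℕ} (hw : w ≤ n)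
    (G : ℕ → NSeq α) :
    ∃ C : Context α, ∀ Δ, treeSeq par n (G + Pi.single w Δ) = C.fill Δ := by
  obtain ⟨C, L, hL, hC⟩ := exists_fill_eq_treeSeq hpar hw (k := 0) rfl G
  rw [List.length_eq_zero_iff] at hL
  subst hL
  exact ⟨C, fun Δ => by simpa [NSeq.nest] using hC 0 Δ⟩

/-- Absorbing a leaf adds to its parent a bracket that is false there, since the world of the leaf
is a successor that refutes its content. -/
theorem not_sat_treeSeq {W : Type v} (M : Model α W) (b : ℕ → W) {par : ℕ → ℕ} {n : ℕ}
    (hb : ∀ i < n, M.rel (b (par i)) (b (i + 1)))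
    {G : ℕ → NSeq α} (hG : ∀ i ≤ n, ¬ (G i).Sat M (b i)) :
    ¬ (treeSeq par n G).Sat M (b 0) := by
  induction n generalizing G with
  | zero => exact hG 0 le_rfl
  | succ n ih =>
    refine ih (fun i hi => hb i (by omega)) fun i hi => ?_
    rw [Pi.add_apply, NSeq.sat_add, not_or]
    refine ⟨hG i (by omega), ?_⟩
    by_cases hi' : i = par n
    · subst hi'
      rw [Pi.single_eq_same, NSeq.sat_brk]
      exact fun h => hG (n + 1) le_rfl (h _ (hb n (by omega)))
    · rw [Pi.single_eq_of_ne hi']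
      exact NSeq.sat_zero M _

/-- The sequent of a multiset of formulas. -/
def NSeq.fmls : Multiset (Formula α) →+ NSeq α where
  toFun s := (s.map NSeq.fml).sum
  map_zero' := by simp
  map_add' := by simp

theorem NSeq.fmls_singleton (A : Formula α) : NSeq.fmls {A} = NSeq.fml A :=
  Multiset.sum_singleton _

theorem NSeq.sat_fmls {W : Type v} (M : Model α W) (s : Multiset (Formula α)) (x : W) :
    (NSeq.fmls s).Sat M x ↔ ∃ A ∈ s, A.Sat M x := by
  induction s using Multiset.induction with
  | empty => simpa using NSeq.sat_zero M x
  | cons A s ih =>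
    rw [← Multiset.singleton_add, map_add, NSeq.sat_add, ih, NSeq.fmls_singleton, NSeq.sat_fml]
    simp

/-- Nested sequents with named nodes: a finite tree with nodes `0, …, n`, in which `par i` is the
parent of `i + 1`, and a multiset of formulas at every node. -/
structure TreeSequent (α : Type u) where
  n : ℕ
  par : ℕ → ℕ
  par_le : ∀ i, par i ≤ i
  fmls : ℕ → Multiset (Formula α)

namespace TreeSequent

/-- The nested sequent of a tree sequent. -/
def toNSeq (M : TreeSequent α) : NSeq α := treeSeq M.par M.n fun i => NSeq.fmls (M.fmls i)

/-- The child relation of a tree sequent. -/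
def Child (M : TreeSequent α) : ℕ → ℕ → Prop := IsChild M.par M.n

/-- The tree sequent with the formulas at the nodes replaced. -/
def withFmls (M : TreeSequent α) (F : ℕ → Multiset (Formula α)) : TreeSequent α :=
  { M with fmls := F }

/-- The tree sequent with a new leaf below the node `w`. -/
def addLeaf (M : TreeSequent α) (w : ℕ) (hw : w ≤ M.n) (s : Multiset (Formula α)) :
    TreeSequent α where
  n := M.n + 1
  par := Function.update M.par M.n w
  par_le i := by
    rcases eq_or_ne i M.n with rfl | hi
    · simpa using hw
    · simpa [hi] using M.par_le i
  fmls := Function.update M.fmls (M.n + 1) s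

theorem child_addLeaf_new (M : TreeSequent α) {w : ℕ} (hw : w ≤ M.n) (s : Multiset (Formula α)) :
    (M.addLeaf w hw s).Child w (M.n + 1) :=
  ⟨M.n, Nat.lt_succ_self _, rfl, by simp [addLeaf]⟩

theorem Child.addLeaf {M : TreeSequent α} {w : ℕ} (hw : w ≤ M.n) (s : Multiset (Formula α))
    {x y : ℕ} (h : M.Child x y) : (M.addLeaf w hw s).Child x y := by
  obtain ⟨i, hi, rfl, rfl⟩ := h
  exact ⟨i, Nat.lt_succ_of_lt hi, rfl, by simp [TreeSequent.addLeaf, hi.ne]⟩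

theorem treeSeq_addLeaf (M : TreeSequent α) {w : ℕ} (hw : w ≤ M.n) (s : Multiset (Formula α))
    (G : ℕ → NSeq α) :
    treeSeq (M.addLeaf w hw s).par (M.n + 1) G =
      treeSeq M.par M.n (G + Pi.single w (.brk (G (M.n + 1)))) := by
  rw [treeSeq]
  refine treeSeq_congr (fun i hi => by simp [addLeaf, hi.ne]) fun i _ => by simp [addLeaf]

/-- Unfolds a written sequent at the node `w`. `G` holds material that is to stay folded; it
vanishes beyond the current nodes so that new leaves start empty. -/
theorem exists_treeSeq_eq_add_single (Δ : PreSeq α) (M : TreeSequent α) {w : ℕ} (hw : w ≤ M.n)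
    (G : ℕ → NSeq α) (hG : ∀ i, M.n < i → G i = 0) :
    ∃ M' : TreeSequent α, M.n ≤ M'.n ∧
      treeSeq M'.par M'.n ((fun i => NSeq.fmls (M'.fmls i)) + G) =
        treeSeq M.par M.n ((fun i => NSeq.fmls (M.fmls i)) + G + Pi.single w (NSeq.mk Δ)) := by
  induction Δ generalizing M w G with
  | nil => exact ⟨M, le_rfl, by simp [NSeq.mk_nil]⟩
  | fml A Γ ih =>
    obtain ⟨M', hn, h⟩ := ih (M.withFmls (M.fmls + Pi.single w {A})) hw G hG
    refine ⟨M', hn, h.trans (treeSeq_congr (fun _ _ => rfl) fun i _ => ?_)⟩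
    rcases eq_or_ne i w with rfl | hi
    · simp only [withFmls, NSeq.mk_fml, Pi.add_apply, Pi.single_eq_same, map_add,
        NSeq.fmls_singleton]
      abel
    · simp [withFmls, hi]
  | brk Δ Γ ihΔ ihΓ =>
    have hG' : ∀ i, M.n + 1 < i → (G + Pi.single w (NSeq.mk Γ) : ℕ → NSeq α) i = 0 := fun i hi => by
      have hi' : i ≠ w := by omega
      simp [hG i (by omega), hi']
    -- The content of the bracket is unfolded at a fresh empty leaf while `Γ` is parked in `G` at
    -- `w`; `Γ` is unfolded afterwards.
    obtain ⟨M₁, hn₁, h₁⟩ := ihΔ (M.addLeaf w hw 0) (w := M.n + 1) le_rfl _ hG'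
    have hn₁ : M.n + 1 ≤ M₁.n := hn₁
    obtain ⟨M₂, hn₂, h₂⟩ := ihΓ M₁ (w := w) (by omega) G fun i hi => hG i (by omega)
    refine ⟨M₂, by omega, ?_⟩
    rw [h₂, add_assoc, h₁]
    change treeSeq _ (M.n + 1) _ = _
    rw [treeSeq_addLeaf]
    have hnw : M.n + 1 ≠ w := by omega
    refine treeSeq_congr (fun _ _ => rfl) fun i hi => ?_
    have hi' : i ≠ M.n + 1 := by omega
    rcases eq_or_ne i w with rfl | hiw
    · simp [addLeaf, hi', hnw, hG, NSeq.mk_brk]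
      abel
    · simp [addLeaf, hi', hiw]

theorem exists_toNSeq_eq (Γ : NSeq α) : ∃ M : TreeSequent α, M.toNSeq = Γ := by
  obtain ⟨Γ⟩ := Γ
  obtain ⟨M, -, h⟩ := exists_treeSeq_eq_add_single Γ ⟨0, fun _ => 0, fun _ => Nat.zero_le _, 0⟩
    (w := 0) le_rfl 0 fun _ _ => rfl
  refine ⟨M, ?_⟩
  simp only [add_zero] at h
  rw [toNSeq, h]
  simp [treeSeq, NSeq.mk]
  rfl

end TreeSequent

/-! ### Covering: formulas present up to decomposition -/

namespace TreeSequent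

/-- `M.Cov A w`: the formula `A` occurs at the node `w`, or the tree sequent contains, at and below
`w`, what is left of `A` after some of the rules for `∧`, `∨` and `□` have been applied to it from
conclusion to premiss. -/
def Cov (M : TreeSequent α) : Formula α → ℕ → Prop
  | .atom p, w => .atom p ∈ M.fmls w
  | .natom p, w => .natom p ∈ M.fmls w
  | .and A B, w => .and A B ∈ M.fmls w ∨ M.Cov A w ∨ M.Cov B w
  | .or A B, w => .or A B ∈ M.fmls w ∨ M.Cov A w ∧ M.Cov B w
  | .box A, w => .box A ∈ M.fmls w ∨ ∃ v, M.Child w v ∧ M.Cov A v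
  | .dia A, w => .dia A ∈ M.fmls w

theorem cov_of_mem {M : TreeSequent α} {A : Formula α} {w : ℕ} (h : A ∈ M.fmls w) :
    M.Cov A w := by
  cases A with
  | atom | natom | dia => exact h
  | and | or | box => exact .inl h

theorem Child.lt {M : TreeSequent α} {w v : ℕ} (h : M.Child w v) : w < v ∧ v ≤ M.n :=
  IsChild.lt M.par_le h

/-- Occurrences in `M` need only be covered in `M'`, not occur there, so a rule may replace its
principal formula by the residue. -/
theorem Cov.mono {M M' : TreeSequent α} (hc : ∀ w v, M.Child w v → M'.Child w v)
    (hF : ∀ A, ∀ w ≤ M.n, A ∈ M.fmls w → M'.Cov A w) {A : Formula α} {w : ℕ} (hw : w ≤ M.n)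
    (h : M.Cov A w) : M'.Cov A w := by
  induction A generalizing w with
  | atom | natom | dia => exact hF _ w hw h
  | and A B ihA ihB =>
    rcases h with h | h | h
    · exact hF _ w hw h
    · exact .inr (.inl (ihA hw h))
    · exact .inr (.inr (ihB hw h))
  | or A B ihA ihB =>
    rcases h with h | ⟨hA, hB⟩
    · exact hF _ w hw h
    · exact .inr ⟨ihA hw hA, ihB hw hB⟩
  | box A ih =>
    rcases h with h | ⟨v, hv, h⟩
    · exact hF _ w hw h
    · exact .inr ⟨v, hc w v hv, ih hv.lt.2 h⟩

theorem exists_fmls_eq_add_single {M : TreeSequent α} {A : Formula α} {w : ℕ}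
    (h : A ∈ M.fmls w) : ∃ F : ℕ → Multiset (Formula α), M = M.withFmls (F + Pi.single w {A}) := by
  obtain ⟨s, hs⟩ := Multiset.exists_cons_of_mem h
  refine ⟨Function.update M.fmls w s, ?_⟩
  cases M
  simp only [withFmls, mk.injEq, true_and]
  funext i
  rcases eq_or_ne i w with rfl | hi
  · simpa [← Multiset.singleton_add, add_comm] using hs
  · simp [hi]

theorem fmls_add_single (F : ℕ → Multiset (Formula α)) (w : ℕ) (s : Multiset (Formula α)) :
    (fun i => NSeq.fmls ((F + Pi.single w s : ℕ → Multiset (Formula α)) i)) =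
      (fun i => NSeq.fmls (F i)) + Pi.single w (NSeq.fmls s) := by
  funext i
  rcases eq_or_ne i w with rfl | hi
  · simp
  · simp [hi]

/-- One context serves both a change of the formulas at `w` and a new leaf below `w`. The second
form is the premiss of the `□` rule. -/
theorem exists_fill_eq_withFmls (M : TreeSequent α) {w : ℕ} (hw : w ≤ M.n)
    (F : ℕ → Multiset (Formula α)) :
    ∃ C : Context α, (∀ s, (M.withFmls (F + Pi.single w s)).toNSeq = C.fill (NSeq.fmls s)) ∧
      ∀ s, ((M.withFmls F).addLeaf w hw s).toNSeq = C.fill (.brk (NSeq.fmls s)) := by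
  obtain ⟨C, hC⟩ := exists_fill_eq_treeSeq_node M.par_le hw fun i => NSeq.fmls (F i)
  refine ⟨C, fun s => ?_, fun s => ?_⟩
  · rw [toNSeq, withFmls, fmls_add_single]
    exact hC _
  · rw [toNSeq]
    refine ((M.withFmls F).treeSeq_addLeaf hw s _).trans (.trans ?_ (hC _))
    refine treeSeq_congr (fun _ _ => rfl) fun i hi => ?_
    have hi' : i ≠ M.n + 1 := by
      have : i ≤ M.n := hi
      omega
    simp [addLeaf, withFmls, hi']

end TreeSequent

/-! ### Labelled items and their derivability -/

/-- Names of worlds: the nodes of a tree, and a witness `wit x A` for the failure of `□A` at `x`. -/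
inductive Label (α : Type u) : Type u
  | base (i : ℕ)
  | wit (x : Label α) (A : Formula α)

/-- Relational atoms and labelled formulas. -/
inductive Item (α : Type u) : Type u
  | rel (x y : Label α)
  | lab (x : Label α) (A : Formula α)

/-- The tree sequent `M` covers an item when the labels are interpreted as nodes by `f`. -/
def Item.Covered (M : TreeSequent α) (f : Label α → ℕ) : Item α → Prop
  | .rel x y => M.Child (f x) (f y)
  | .lab x A => f x ≤ M.n ∧ M.Cov A (f x)

/-- A set of items is derivable if all tree sequents that cover it are cut-free provable. -/
def Derivable (Y : Set ℕ) (S : Set (Item α)) : Prop :=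
  ∀ (M : TreeSequent α) (f : Label α → ℕ), (∀ i ∈ S, i.Covered M f) →
    Provable (nK ⊔ diaK Y) M.toNSeq

theorem Item.Covered.mono {M M' : TreeSequent α} {f : Label α → ℕ} (hn : M.n ≤ M'.n)
    (hc : ∀ w v, M.Child w v → M'.Child w v)
    (hF : ∀ A, ∀ w ≤ M.n, A ∈ M.fmls w → M'.Cov A w) {i : Item α} (h : i.Covered M f) :
    i.Covered M' f := by
  cases i with
  | rel x y => exact hc _ _ h
  | lab x A => exact ⟨h.1.trans hn, h.2.mono hc hF h.1⟩

theorem Item.Covered.replace {M : TreeSequent α} {f : Label α → ℕ} {F : ℕ → Multiset (Formula α)}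
    {w : ℕ} {A : Formula α} {s : Multiset (Formula α)}
    (hA : (M.withFmls (F + Pi.single w s)).Cov A w) {i : Item α}
    (h : i.Covered (M.withFmls (F + Pi.single w {A})) f) :
    i.Covered (M.withFmls (F + Pi.single w s)) f := by
  refine h.mono (by exact le_refl M.n) (fun _ _ h => by exact h)
    fun B v _ hB => ?_
  rcases Multiset.mem_add.1 hB with hB | hB
  · exact TreeSequent.cov_of_mem (Multiset.mem_add.2 (.inl hB))
  · rcases eq_or_ne v w with rfl | hv
    · simp only [Pi.single_eq_same, Multiset.mem_singleton] at hB
      exact hB ▸ hA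
    · simp [hv] at hB

namespace Derivable

variable {Y : Set ℕ} {S T : Set (Item α)}

theorem mono (hST : S ⊆ T) (h : Derivable Y S) : Derivable Y T :=
  fun M f hT => h M f fun i hi => hT i (hST hi)

theorem id {x : Label α} {p : α} (h₁ : .lab x (.atom p) ∈ S) (h₂ : .lab x (.natom p) ∈ S) :
    Derivable Y S := by
  intro M f hS
  obtain ⟨hn, h₁⟩ := hS _ h₁
  obtain ⟨-, h₂⟩ := hS _ h₂
  obtain ⟨F, hF⟩ := TreeSequent.exists_fmls_eq_add_single h₁
  have h₂ : .natom p ∈ M.fmls (f x) := h₂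
  rw [hF] at h₂
  have h₂ : .natom p ∈ (M.withFmls F).fmls (f x) := by simpa [TreeSequent.withFmls] using h₂
  obtain ⟨F', hF'⟩ := TreeSequent.exists_fmls_eq_add_single h₂
  have hF' : F = F' + Pi.single (f x) {.natom p} := congrArg TreeSequent.fmls hF'
  obtain ⟨C, hC, -⟩ := M.exists_fill_eq_withFmls hn F'
  rw [hF, hF', add_assoc, ← Pi.single_add, hC, add_comm, map_add, NSeq.fmls_singleton,
    NSeq.fmls_singleton]
  exact .intro (.inl (.id C p)) (by simp)

/-- If the disjunction occurs in the tree, the rule replaces it by both disjuncts, and it stays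
covered through them. If it was decomposed earlier, the disjuncts are already covered and no rule is
applied. -/
theorem or {x : Label α} {A B : Formula α}
    (hx : .lab x (.or A B) ∈ S)
    (h : Derivable Y (insert (.lab x A) (insert (.lab x B) S))) : Derivable Y S := by
  intro M f hS
  obtain ⟨hn, hx | hx⟩ := hS _ hx
  · obtain ⟨F, hF⟩ := TreeSequent.exists_fmls_eq_add_single hx
    obtain ⟨C, hC, -⟩ := M.exists_fill_eq_withFmls hn F
    have hA : (M.withFmls (F + Pi.single (f x) {A, B})).Cov A (f x) :=
      TreeSequent.cov_of_mem (by simp [TreeSequent.withFmls])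
    have hB : (M.withFmls (F + Pi.single (f x) {A, B})).Cov B (f x) :=
      TreeSequent.cov_of_mem (by simp [TreeSequent.withFmls])
    have := h (M.withFmls (F + Pi.single (f x) {A, B})) f (by
      rintro i (rfl | rfl | hi)
      · exact ⟨hn, hA⟩
      · exact ⟨hn, hB⟩
      · have := hS i hi
        rw [hF] at this
        exact this.replace (A := .or A B) (.inr ⟨hA, hB⟩))
    rw [hC, show ({A, B} : Multiset (Formula α)) = {A} + {B} from rfl, map_add,
      NSeq.fmls_singleton, NSeq.fmls_singleton] at this
    rw [hF, hC, NSeq.fmls_singleton]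
    exact .intro (.inl (.or C A B)) (by simpa using this)
  · refine h M f ?_
    rintro i (rfl | rfl | hi)
    · exact ⟨hn, hx.1⟩
    · exact ⟨hn, hx.2⟩
    · exact hS i hi

theorem and {x : Label α} {A B : Formula α}
    (hx : .lab x (.and A B) ∈ S)
    (hA : Derivable Y (insert (.lab x A) S)) (hB : Derivable Y (insert (.lab x B) S)) :
    Derivable Y S := by
  intro M f hS
  obtain ⟨hn, hx | hx | hx⟩ := hS _ hx
  · obtain ⟨F, hF⟩ := TreeSequent.exists_fmls_eq_add_single hx
    obtain ⟨C, hC, -⟩ := M.exists_fill_eq_withFmls hn F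
    have key : ∀ D, (D = A ∨ D = B) → Derivable Y (insert (.lab x D) S) →
        Provable (nK ⊔ diaK Y) (C.fill (.fml D)) := by
      intro D hD h
      have hDw : (M.withFmls (F + Pi.single (f x) {D})).Cov D (f x) :=
        TreeSequent.cov_of_mem (by simp [TreeSequent.withFmls])
      rw [← NSeq.fmls_singleton, ← hC]
      refine h _ f ?_
      rintro i (rfl | hi)
      · exact ⟨hn, hDw⟩
      · have := hS i hi
        rw [hF] at this
        refine this.replace (A := .and A B) (.inr ?_)
        rcases hD with rfl | rfl
        · exact .inl hDw
        · exact .inr hDw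
    rw [hF, hC, NSeq.fmls_singleton]
    exact .intro (.inl (.and C A B)) (by simp [key A (.inl rfl) hA, key B (.inr rfl) hB])
  · refine hA M f ?_
    rintro i (rfl | hi)
    exacts [⟨hn, hx⟩, hS i hi]
  · refine hB M f ?_
    rintro i (rfl | hi)
    exacts [⟨hn, hx⟩, hS i hi]

/-- The label `y` is fresh for `S`, so its interpretation can be changed freely: to the new leaf
made by the `□` rule, or to the existing child if the box was decomposed earlier. -/
theorem box {x y : Label α} {A : Formula α} (hx : .lab x (.box A) ∈ S)
    (hyl : ∀ B, .lab y B ∉ S) (hyr : ∀ z, .rel y z ∉ S ∧ .rel z y ∉ S)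
    (h : Derivable Y (insert (.rel x y) (insert (.lab y A) S))) : Derivable Y S := by
  classical
  intro M f hS
  have hxy : x ≠ y := fun h => hyl _ (h ▸ hx)
  have hf : ∀ (M' : TreeSequent α) (v : ℕ), ∀ i ∈ S, i.Covered M' f →
      i.Covered M' (Function.update f y v) := by
    intro M' v i hi hc
    cases i with
    | rel z z' =>
      have h₁ : z ≠ y := fun h => (hyr z').1 (h ▸ hi)
      have h₂ : z' ≠ y := fun h => (hyr z).2 (h ▸ hi)
      simpa [Item.Covered, h₁, h₂] using hc
    | lab z B =>
      have h₁ : z ≠ y := fun h => hyl B (h ▸ hi)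
      simpa [Item.Covered, h₁] using hc
  obtain ⟨hn, hx | ⟨v, hv, hx⟩⟩ := hS _ hx
  · obtain ⟨F, hF⟩ := TreeSequent.exists_fmls_eq_add_single hx
    obtain ⟨C, hC, hC'⟩ := M.exists_fill_eq_withFmls hn F
    set M' := (M.withFmls F).addLeaf (f x) hn {A} with hM'
    have hch : M'.Child (f x) (M.n + 1) := (M.withFmls F).child_addLeaf_new hn {A}
    have hA : M'.Cov A (M.n + 1) := TreeSequent.cov_of_mem (by
      simp [hM', TreeSequent.addLeaf, TreeSequent.withFmls])
    have := h M' (Function.update f y (M.n + 1)) (by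
      rintro i (rfl | rfl | hi)
      · simpa [Item.Covered, hxy] using hch
      · simpa [Item.Covered] using ⟨le_refl (M.n + 1), hA⟩
      · refine hf _ _ i hi ((hS i hi).mono (Nat.le_succ _) (fun w v h => ?_) fun B w hw hB => ?_)
        · exact TreeSequent.Child.addLeaf (M := M.withFmls F) hn {A} h
        · rw [hF] at hB
          rcases Multiset.mem_add.1 hB with hB | hB
          · refine TreeSequent.cov_of_mem ?_
            have hw' : w ≠ M.n + 1 := by omega
            simpa [hM', TreeSequent.addLeaf, TreeSequent.withFmls, hw'] using hB
          · rcases eq_or_ne w (f x) with rfl | hw'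
            · simp only [Pi.single_eq_same, Multiset.mem_singleton] at hB
              subst hB
              exact .inr ⟨_, hch, hA⟩
            · simp [hw'] at hB)
    rw [hC', NSeq.fmls_singleton] at this
    rw [hF, hC, NSeq.fmls_singleton]
    exact .intro (.inl (.box C A)) (by simpa using this)
  · refine h M (Function.update f y v) ?_
    rintro i (rfl | rfl | hi)
    · simpa [Item.Covered, hxy] using hv
    · simpa [Item.Covered] using ⟨hv.lt.2, hx⟩
    · exact hf _ _ i hi (hS i hi)

/-- Relational atoms are interpreted by child edges, so the path becomes a branch of the same length
`k`. The rule is `◇` of `nK` for `k = 1` and a propagation rule for `k ∈ Y`. -/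
theorem dia {x y : Label α} {A : Formula α} {k : ℕ} (hk : k = 1 ∨ k ∈ Y)
    (hx : .lab x (.dia A) ∈ S) (hxy : Path (fun z z' => .rel z z' ∈ S) k x y)
    (h : Derivable Y (insert (.lab y A) S)) : Derivable Y S := by
  intro M f hS
  obtain ⟨hn, hx'⟩ := hS _ hx
  have hpath : Path M.Child k (f x) (f y) ∧ f y ≤ M.n := by
    clear hk hx hx'
    induction k generalizing x with
    | zero => cases hxy; exact ⟨rfl, hn⟩
    | succ k ih =>
      obtain ⟨z, hz, hxy⟩ := hxy
      have hz : M.Child (f x) (f z) := hS _ hz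
      exact ⟨⟨f z, hz, (ih hxy hz.lt.2).1⟩, (ih hxy hz.lt.2).2⟩
  obtain ⟨F, hF⟩ := TreeSequent.exists_fmls_eq_add_single hx'
  obtain ⟨C, L, hL, hC⟩ := exists_fill_eq_treeSeq M.par_le hpath.2 hpath.1
    fun i => NSeq.fmls (F i)
  have key : ∀ s, (M.withFmls (F + Pi.single (f x) {.dia A} + Pi.single (f y) s)).toNSeq =
      C.fill (.fml (.dia A) + NSeq.nest L (NSeq.fmls s)) := by
    intro s
    rw [TreeSequent.toNSeq, TreeSequent.withFmls, TreeSequent.fmls_add_single,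
      TreeSequent.fmls_add_single, NSeq.fmls_singleton]
    exact hC _ _
  have hprem := h (M.withFmls (F + Pi.single (f x) {.dia A} + Pi.single (f y) {A})) f (by
    rintro i (rfl | hi)
    · exact ⟨hpath.2, TreeSequent.cov_of_mem (by simp [TreeSequent.withFmls])⟩
    · refine (hS i hi).mono (by exact le_refl M.n) (fun _ _ h => by exact h)
        fun B w _ hB => ?_
      rw [hF] at hB
      exact TreeSequent.cov_of_mem (Multiset.mem_add.2 (.inl hB)))
  rw [key, NSeq.fmls_singleton] at hprem
  -- With `s = 0` the context yields the conclusion of the rule, with `s = {A}` its premiss.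
  have hM := key 0
  rw [Pi.single_zero, add_zero, ← hF, map_zero] at hM
  rw [hM]
  rcases hk with rfl | hk
  · obtain ⟨Δ, rfl⟩ := List.length_eq_one_iff.1 hL
    simp only [NSeq.nest, add_zero] at hprem ⊢
    rw [add_comm Δ] at hprem
    exact .intro (.inl (.dia C A Δ)) (by simpa using hprem)
  · exact .intro (.inr (.mk C A L (hL ▸ hk))) (by simpa using hprem)

end Derivable

/-! ### Maximal consistent sets -/

/-- A set of items is consistent if no finite subset is derivable. -/
def Consistent (Y : Set ℕ) (S : Set (Item α)) : Prop :=
  ∀ T ⊆ S, T.Finite → ¬ Derivable Y T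

/-- The label `y` occurs in the set `S`. -/
def Occurs (S : Set (Item α)) (y : Label α) : Prop :=
  (∃ A, .lab y A ∈ S) ∨ ∃ z, .rel y z ∈ S ∨ .rel z y ∈ S

/-- Witnesses occur in `S` only as such. -/
def Witnessed (S : Set (Item α)) : Prop :=
  ∀ x A, Occurs S (.wit x A) → .rel x (.wit x A) ∈ S ∧ .lab (.wit x A) A ∈ S

theorem Witnessed.insert_lab {S : Set (Item α)} (hS : Witnessed S) {y : Label α} (hy : Occurs S y)
    (A : Formula α) : Witnessed (insert (.lab y A) S) := by
  intro x B h
  have : Occurs S (.wit x B) := by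
    simp only [Occurs, Set.mem_insert_iff, Item.lab.injEq, reduceCtorEq, false_or] at h
    rcases h with ⟨C, ⟨rfl, rfl⟩ | h⟩ | h
    · exact hy
    · exact .inl ⟨C, h⟩
    · exact .inr h
  exact (hS x B this).imp .inr .inr

theorem Witnessed.insert_wit {S : Set (Item α)} (hS : Witnessed S) {x : Label α} (hx : Occurs S x)
    (A : Formula α) :
    Witnessed (insert (.rel x (.wit x A)) (insert (.lab (.wit x A) A) S)) := by
  intro z B h
  have : Occurs S (.wit z B) ∨ Label.wit z B = .wit x A := by
    simp only [Occurs, Set.mem_insert_iff, Item.lab.injEq, Item.rel.injEq, reduceCtorEq,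
      false_or] at h
    rcases h with ⟨C, ⟨h, -⟩ | h⟩ | ⟨y, (⟨h, -⟩ | h) | ⟨-, h⟩ | h⟩
    · exact .inr h
    · exact .inl (.inl ⟨C, h⟩)
    · exact .inl (h ▸ hx)
    · exact .inl (.inr ⟨y, .inl h⟩)
    · exact .inr h
    · exact .inl (.inr ⟨y, .inr h⟩)
  rcases this with h | h
  · exact (hS z B h).imp (fun h => .inr (.inr h)) fun h => .inr (.inr h)
  · simp only [Label.wit.injEq] at h
    obtain ⟨rfl, rfl⟩ := h
    exact ⟨.inl rfl, .inr (.inl rfl)⟩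

/-- Maximality among the consistent sets in which witnesses occur only as such. -/
def MaximalConsistent (Y : Set ℕ) (S : Set (Item α)) : Prop :=
  Maximal (· ∈ {T : Set (Item α) | Consistent Y T ∧ Witnessed T}) S

/-- Zorn's lemma applies: a finite subset of the union of a chain lies in one member, and so does
each occurrence of a witness. -/
theorem exists_maximalConsistent {Y : Set ℕ} {S : Set (Item α)} (hc : Consistent Y S)
    (hw : Witnessed S) :
    ∃ T, S ⊆ T ∧ MaximalConsistent Y T := by
  refine zorn_subset_nonempty _ (fun c hcS hch hne => ?_) S ⟨hc, hw⟩
  refine ⟨⋃₀ c, ⟨fun T hT hfin => ?_, fun x A h => ?_⟩, fun s hs => Set.subset_sUnion_of_mem hs⟩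
  · obtain ⟨s, hs, hTs⟩ :=
      DirectedOn.exists_mem_subset_of_finite_of_subset_sUnion hne hch.directedOn hfin hT
    exact (hcS hs).1 T hTs hfin
  · have : ∃ s ∈ c, Occurs s (.wit x A) := by
      rcases h with ⟨B, s, hs, h⟩ | ⟨z, ⟨s, hs, h⟩ | ⟨s, hs, h⟩⟩
      · exact ⟨s, hs, .inl ⟨B, h⟩⟩
      · exact ⟨s, hs, .inr ⟨z, .inl h⟩⟩
      · exact ⟨s, hs, .inr ⟨z, .inr h⟩⟩
    obtain ⟨s, hs, h⟩ := this
    exact ((hcS hs).2 x A h).imp (fun h => ⟨s, hs, h⟩) fun h => ⟨s, hs, h⟩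

theorem Path.mono {W : Type v} {R R' : W → W → Prop} (hR : ∀ x y, R x y → R' x y) {k : ℕ}
    {x y : W} (h : Path R k x y) : Path R' k x y := by
  induction k generalizing x with
  | zero => exact h
  | succ k ih =>
    obtain ⟨z, hz, h⟩ := h
    exact ⟨z, hR _ _ hz, ih h⟩

theorem Path.exists_finite {S : Set (Item α)} {k : ℕ} {x y : Label α}
    (h : Path (fun z z' => .rel z z' ∈ S) k x y) :
    ∃ T ⊆ S, T.Finite ∧ Path (fun z z' => .rel z z' ∈ T) k x y := by
  induction k generalizing x with
  | zero => exact ⟨∅, Set.empty_subset S, Set.finite_empty, h⟩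
  | succ k ih =>
    obtain ⟨z, hz, h⟩ := h
    obtain ⟨T, hT, hfin, h⟩ := ih h
    exact ⟨insert (.rel x z) T, Set.insert_subset hz hT, hfin.insert _, z, .inl rfl,
      h.mono fun _ _ h => .inr h⟩

namespace MaximalConsistent

variable {Y : Set ℕ} {S : Set (Item α)}

/-- By maximality `U ∪ S` must be inconsistent; `T` is the part in `S` of a finite derivable subset.
-/
theorem exists_derivable_of_not_subset
    (hS : MaximalConsistent Y S) {U : Set (Item α)}
    (hU : Witnessed (U ∪ S)) (hUS : ¬ U ⊆ S) :
    ∃ T ⊆ S, T.Finite ∧ Derivable Y (U ∪ T) := by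
  by_contra! hn
  refine hUS (Set.subset_union_left.trans (hS.2 ⟨fun T hT hfin h => ?_, hU⟩
    Set.subset_union_right))
  refine hn (T ∩ S) Set.inter_subset_right (hfin.inter_of_left S) (h.mono fun i hi => ?_)
  rcases hT hi with hi' | hi'
  exacts [.inl hi', .inr ⟨hi, hi'⟩]

theorem exists_derivable_of_lab_notMem
    (hS : MaximalConsistent Y S) {y : Label α}
    (hy : Occurs S y) {A : Formula α} (hA : .lab y A ∉ S) :
    ∃ T ⊆ S, T.Finite ∧ Derivable Y (insert (.lab y A) T) := by
  refine exists_derivable_of_not_subset hS (U := {.lab y A}) ?_ (by simpa using hA)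
  exact hS.1.2.insert_lab hy A

theorem lab_and_lab_of_or (hS : MaximalConsistent Y S) {x : Label α} {A B : Formula α}
    (hx : .lab x (.or A B) ∈ S) :
    .lab x A ∈ S ∧ .lab x B ∈ S := by
  have key : ∀ D, (D = A ∨ D = B) → .lab x D ∈ S := by
    intro D hD
    by_contra hn
    obtain ⟨T, hT, hfin, h⟩ := exists_derivable_of_lab_notMem hS (.inl ⟨_, hx⟩) hn
    refine hS.1.1 _ (Set.insert_subset hx hT) (hfin.insert _)
      (Derivable.or (Set.mem_insert _ _) (h.mono ?_))
    rcases hD with rfl | rfl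
    · exact Set.insert_subset_insert fun i hi => .inr (.inr hi)
    · exact fun i hi => .inr (hi.imp_right .inr)
  exact ⟨key A (.inl rfl), key B (.inr rfl)⟩

theorem lab_or_lab_of_and (hS : MaximalConsistent Y S) {x : Label α} {A B : Formula α}
    (hx : .lab x (.and A B) ∈ S) :
    .lab x A ∈ S ∨ .lab x B ∈ S := by
  by_contra! hn
  obtain ⟨T, hT, hTf, hA⟩ := exists_derivable_of_lab_notMem hS (.inl ⟨_, hx⟩) hn.1
  obtain ⟨U, hU, hUf, hB⟩ := exists_derivable_of_lab_notMem hS (.inl ⟨_, hx⟩) hn.2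
  refine hS.1.1 _ (Set.insert_subset hx (Set.union_subset hT hU)) ((hTf.union hUf).insert _)
    (Derivable.and (Set.mem_insert _ _) (hA.mono ?_) (hB.mono ?_))
  · exact Set.insert_subset_insert fun i hi => .inr (.inl hi)
  · exact Set.insert_subset_insert fun i hi => .inr (.inr hi)

theorem rel_and_lab_of_box (hS : MaximalConsistent Y S) {x : Label α} {A : Formula α}
    (hx : .lab x (.box A) ∈ S) :
    .rel x (.wit x A) ∈ S ∧ .lab (.wit x A) A ∈ S := by
  -- A witness that occurs does so with its defining items, by `Witnessed`. One that does not occur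
  -- is fresh, as `Derivable.box` requires.
  by_cases ho : Occurs S (.wit x A)
  · exact hS.1.2 x A ho
  by_contra hn
  obtain ⟨T, hT, hfin, h⟩ := exists_derivable_of_not_subset hS
    (U := {.rel x (.wit x A), .lab (.wit x A) A})
    (by simpa [Set.insert_union] using hS.1.2.insert_wit (.inl ⟨_, hx⟩) A)
    (by simpa [Set.insert_subset_iff] using hn)
  have hT' := Set.insert_subset hx hT
  refine hS.1.1 _ hT' (hfin.insert _) (Derivable.box (y := .wit x A) (Set.mem_insert _ _)
    (fun B hB => ho (.inl ⟨B, hT' hB⟩))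
    (fun z => ⟨fun hz => ho (.inr ⟨z, .inl (hT' hz)⟩), fun hz => ho (.inr ⟨z, .inr (hT' hz)⟩)⟩)
    (h.mono ?_))
  rintro i ((hi | hi) | hi)
  exacts [.inl hi, .inr (.inl hi), .inr (.inr (.inr hi))]

theorem lab_of_dia (hS : MaximalConsistent Y S) {x y : Label α} {A : Formula α} {k : ℕ}
    (hk : k = 1 ∨ k ∈ Y) (hx : .lab x (.dia A) ∈ S)
    (hxy : Path (fun z z' => .rel z z' ∈ S) k x y) : .lab y A ∈ S := by
  have hy : Occurs S y := by
    cases k with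
    | zero => exact .inl ⟨_, hxy ▸ hx⟩
    | succ k =>
      obtain ⟨z, -, hz⟩ := hxy.exists_last
      exact .inr ⟨z, .inr hz⟩
  by_contra hn
  obtain ⟨T, hT, hTf, h⟩ := exists_derivable_of_lab_notMem hS hy hn
  obtain ⟨U, hU, hUf, hpath⟩ := hxy.exists_finite
  refine hS.1.1 _ (Set.insert_subset hx (Set.union_subset hT hU)) ((hTf.union hUf).insert _)
    (Derivable.dia hk (Set.mem_insert _ _) (hpath.mono fun _ _ hz => .inr (.inr hz)) (h.mono ?_))
  exact Set.insert_subset_insert fun i hi => .inr (.inl hi)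

end MaximalConsistent

/-! ### The canonical model -/

/-- The Kripke model of a set of items: the worlds are the labels, and the relation is generated by
the relational atoms. -/
def canonicalModel (Y : Set ℕ) (S : Set (Item α)) : Model α (Label α) where
  rel x y := ∃ k, (k = 1 ∨ k ∈ Y) ∧ Path (fun z z' => .rel z z' ∈ S) k x y
  val x p := .lab x (.atom p) ∉ S

/-- Membership in `S` means falsity. Each case is a saturation property of `S`; for atoms it is the
choice of valuation, and for negated atoms consistency with respect to `id`. -/
theorem MaximalConsistent.not_sat {Y : Set ℕ} {S : Set (Item α)} (hS : MaximalConsistent Y S)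
    {x : Label α} {A : Formula α} (h : .lab x A ∈ S) : ¬ A.Sat (canonicalModel Y S) x := by
  induction A generalizing x with
  | atom p => exact fun hn => hn h
  | natom p =>
    refine fun hn => hn fun hp => hS.1.1 {.lab x (.atom p), .lab x (.natom p)} ?_ (by simp)
      (Derivable.id (.inl rfl) (.inr rfl))
    exact Set.insert_subset hp (Set.singleton_subset_iff.2 h)
  | and A B ihA ihB =>
    rcases hS.lab_or_lab_of_and h with h | h
    · exact fun hn => ihA h hn.1
    · exact fun hn => ihB h hn.2
  | or A B ihA ihB =>
    obtain ⟨hA, hB⟩ := hS.lab_and_lab_of_or h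
    exact not_or.2 ⟨ihA hA, ihB hB⟩
  | box A ih =>
    obtain ⟨hr, hA⟩ := hS.rel_and_lab_of_box h
    exact fun hn => ih hA (hn _ ⟨1, .inl rfl, _, hr, rfl⟩)
  | dia A ih =>
    rintro ⟨y, ⟨k, hk, hxy⟩, hy⟩
    exact ih (hS.lab_of_dia hk h hxy) hy

theorem canonicalModel_rel_of_path {Y : Set ℕ} (hpos : ∀ k ∈ Y, 0 < k)
    (hadd : ∀ m ∈ Y, ∀ n ∈ Y, m + n - 1 ∈ Y) (S : Set (Item α)) {k : ℕ} (hk : k ∈ Y)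
    {x y : Label α} (h : Path (canonicalModel Y S).rel k x y) : (canonicalModel Y S).rel x y := by
  -- `s` is the total excess of the path: the sum of `l - 1` over its steps, where `l` is the length
  -- of the underlying path of atoms. Adding one excess to an element of `Y` is an instance of
  -- `hadd`.
  have key : ∀ j x, Path (canonicalModel Y S).rel j x y →
      ∃ s, Path (fun z z' => .rel z z' ∈ S) (j + s) x y ∧ ∀ m ∈ Y, m + s ∈ Y := by
    intro j
    induction j with
    | zero => exact fun x h => ⟨0, h, fun m hm => hm⟩
    | succ j ih =>
      rintro x ⟨z, ⟨l, hl, hxz⟩, h⟩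
      obtain ⟨s, hzy, hs⟩ := ih z h
      have hl0 : 0 < l := hl.elim (fun h => h ▸ Nat.one_pos) (hpos l)
      refine ⟨s + (l - 1), ?_, fun m hm => ?_⟩
      · rw [show j + 1 + (s + (l - 1)) = l + (j + s) by omega]
        exact hxz.append hzy
      · rcases hl with rfl | hl
        · exact hs m hm
        · rw [show m + (s + (l - 1)) = m + s + l - 1 by omega]
          exact hadd _ (hs m hm) _ hl
  obtain ⟨s, h, hs⟩ := key k x h
  exact ⟨k + s, .inr (hs k hk), h⟩

/-- The items of a tree sequent. -/
def TreeSequent.items (M : TreeSequent α) : Set (Item α) :=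
  {i | ∃ w ≤ M.n, ∃ A ∈ M.fmls w, i = .lab (.base w) A} ∪
    {i | ∃ w v, M.Child w v ∧ i = .rel (.base w) (.base v)}

theorem TreeSequent.witnessed_items (M : TreeSequent α) : Witnessed M.items := by
  intro x A h
  simp [Occurs, items] at h

theorem TreeSequent.consistent_items {Y : Set ℕ} {M : TreeSequent α}
    (hM : ¬ Provable (nK ⊔ diaK Y) M.toNSeq) : Consistent Y M.items := by
  intro T hT _ h
  -- Only base labels occur among the items, so the value at witnesses is arbitrary.
  refine hM (h M (fun | .base w => w | .wit _ _ => 0) fun i hi => ?_)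
  rcases hT hi with ⟨w, hw, A, hA, rfl⟩ | ⟨w, v, hwv, rfl⟩
  · exact ⟨hw, cov_of_mem hA⟩
  · exact hwv

/-! ### Cut-elimination and the completion -/

/-- Completeness of the cut-free calculus, and with it cut-elimination, for sets of propagation
rules closed under composition. -/
theorem Provable.cut_elim {Y : Set ℕ} (hpos : ∀ k ∈ Y, 0 < k)
    (hadd : ∀ m ∈ Y, ∀ n ∈ Y, m + n - 1 ∈ Y) {Γ : NSeq α}
    (h : Provable (nK ⊔ diaK Y ⊔ cut) Γ) : Provable (nK ⊔ diaK Y) Γ := by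
  obtain ⟨M, rfl⟩ := TreeSequent.exists_toNSeq_eq Γ
  by_contra hM
  obtain ⟨S, hMS, hS⟩ :=
    exists_maximalConsistent (TreeSequent.consistent_items hM) M.witnessed_items
  -- Each node is sent to its own label, where all its formulas fail. The sequent is then false at
  -- the root, contrary to soundness with cut.
  refine not_sat_treeSeq (canonicalModel Y S) .base (fun i hi => ?_) (fun i hi => ?_)
    (h.sat (canonicalModel Y S)
      (fun k hk x y => canonicalModel_rel_of_path hpos hadd S hk) (.base 0))
  · exact ⟨1, .inl rfl, _, hMS (.inr ⟨_, _, ⟨i, hi, rfl, rfl⟩, rfl⟩), rfl⟩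
  · rw [NSeq.sat_fmls]
    rintro ⟨A, hA, hsat⟩
    exact hS.not_sat (hMS (.inl ⟨i, hi, A, hA, rfl⟩)) hsat

theorem completionStage_mono (X : Set ℕ) : Monotone (completionStage X) :=
  monotone_nat_of_le_succ fun _ => Set.subset_union_left

theorem add_sub_one_mem_completion {X : Set ℕ} {m n : ℕ} (hm : m ∈ completion X)
    (hn : n ∈ completion X) : m + n - 1 ∈ completion X := by
  obtain ⟨p, hp⟩ := Set.mem_iUnion.1 hm
  obtain ⟨q, hq⟩ := Set.mem_iUnion.1 hn
  exact Set.mem_iUnion.2 ⟨max p q + 1, .inr ⟨m, completionStage_mono X (le_max_left p q) hp, n,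
    completionStage_mono X (le_max_right p q) hq, rfl⟩⟩

theorem one_lt_of_mem_completion {X : Set ℕ} (hX : X ⊆ {n : ℕ | 1 < n}) {k : ℕ}
    (hk : k ∈ completion X) : 1 < k := by
  obtain ⟨p, hp⟩ := Set.mem_iUnion.1 hk
  induction p generalizing k with
  | zero => exact hX hp
  | succ p ih =>
    rcases hp with hp | ⟨m, hm, n, hn, rfl⟩
    · exact ih hk hp
    · have := ih (Set.mem_iUnion.2 ⟨p, hm⟩) hm
      have := ih (Set.mem_iUnion.2 ⟨p, hn⟩) hn
      omega

end NestedModal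

theorem theorem2 {α : Type*} (X : Set ℕ) (hX : X ⊆ {n : ℕ | 1 < n})
    (Γ : NestedModal.NSeq α)
    (h : NestedModal.Provable
      (NestedModal.nK ⊔ NestedModal.diaK (NestedModal.completion X) ⊔ NestedModal.cut) Γ) :
    NestedModal.Provable
      (NestedModal.nK ⊔ NestedModal.diaK (NestedModal.completion X)) Γ :=
  h.cut_elim (fun _ hk => Nat.zero_lt_of_lt (NestedModal.one_lt_of_mem_completion hX hk))
    fun _ hm _ hn => NestedModal.add_sub_one_mem_completion hm hn
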